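/- Let $m\in\mathbb N$ and equip $\mathbb R^n$ and $\mathbb R^{m\times m}\times\mathbb R^m\cong\mathbb R^{m^2+m}$ with their Euclidean structures. Definitions. Let $U\subset\mathbb R^n$ be open. A set-valued map $J:U\rightrightarrows\mathbb R^{k\times n}$ is a conservative Jacobian on $U$ of a locally Lipschitz map $F:U\to\mathbb R^k$ if its values are nonempty, its graph is closed relative to $U$, it is locally bounded, and for every absolutely continuous curve $\gamma$ in $U$, for almost every $t$, one has $\frac{d}{dt}F(\gamma(t))=A\,\dot\gamma(t)$ for all $A\in J(\gamma(t))$. If $k=1$, the corresponding set-valued map $D:U\rightrightarrows\mathbb R^n$ of vectors (so that $\frac{d}{dt}F(\gamma(t))=\langle v,\dot\gamma(t)\rangle$ for all $v\in D(\gamma(t))$, for almost every $t$) is called a conservative gradient of $F$ on $U$. A locally Lipschitz map that has a conservative Jacobian on $U$ is called path differentiable on $U$. Statement. Let $\sigma:\mathbb R^m\to\mathbb R^m$ be the proximal operator of a proper convex function, that is, for every $x$ the point $\sigma(x)$ minimizes $y\mapsto\varphi(y)+\frac12\|y-x\|^2$ for some proper convex $\varphi:\mathbb R^m\to\mathbb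 R\cup\{+\infty\}$. Assume that $\sigma$ has a conservative Jacobian $J_\sigma:\mathbb R^m\rightrightarrows\mathbb R^{m\times m}$ (on $\mathbb R^m$) all of whose values are convex. Call a matrix $W\in\mathbb R^{m\times m}$ monotone if $(I-W)+(I-W)^T\succeq 2\theta I$ for some $\theta>0$. Then for every monotone $W$ and every $b\in\mathbb R^m$ the equation $$z=\sigma(Wz+b)$$ has a unique solution $z=z(W,b)\in\mathbb R^m$. Let moreover $U\subset\mathbb R^{m\times m}\times\mathbb R^m$ be an open set of pairs $(W,b)$ with $W$ monotone (for instance the set of all such pairs), and assume that for all $(W,b)\in U$ and all $J\in J_\sigma(Wz(W,b)+b)$ the matrix $I-JW$ is invertible. Let $\ell:\mathbb R^m\to\mathbb R$ have the conservative gradient $D_\ell:\mathbb R^m\rightrightarrows\mathbb R^m$ on $\mathbb R^m$. Then $g:(W,b)\mapsto\ell(z(W,b))$ is path differentiable on $U$, and it has on $U$ the conservative gradient $$D_g(W,b)=\left\{\left(J^T(I-JW)^{-T}v\,z^T,\ J^T(I-JW)^{-T}v\right):\ J\in J_\sigma(Wz+b),\ v\in D_\ell(z)\right\},\qquad z=z(W,b).$$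 -/

import Mathlib

namespace MonotoneLayer

open MeasureTheory Topology Filter

/-- `ℝ^ι` with its Euclidean structure. -/
abbrev Vec (ι : Type) : Type := EuclideanSpace ℝ ι

/-- An absolutely continuous curve `γ : ℝ → ℝ^ι`: absolutely continuous on every compact
interval. -/
def IsACCurve {ι : Type} [Fintype ι] (γ : ℝ → Vec ι) : Prop :=
  ∀ a b : ℝ, AbsolutelyContinuousOnInterval γ a b

/-- `J` is a conservative Jacobian of `F : ℝ^ι → ℝ^κ` on the set `U` (meant to be open): `F` is
locally Lipschitz on `U`, and the set-valued map `J`, with values sets of `κ × ι` matrices, has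
nonempty values, a graph that is closed relative to `U`, is locally bounded on `U`, and satisfies
the chain rule along all absolutely continuous curves in `U`, for all elements of `J (γ t)`. -/
structure IsConservativeJacobianOn {ι κ : Type} [Fintype ι] [DecidableEq ι] [Fintype κ]
    (U : Set (Vec ι)) (F : Vec ι → Vec κ) (J : Vec ι → Set (Matrix κ ι ℝ)) : Prop where
  locallyLipschitz : LocallyLipschitzOn U F
  nonempty : ∀ x ∈ U, (J x).Nonempty
  closedGraph : ∀ (x : Vec ι) (A : Matrix κ ι ℝ) (xs : ℕ → Vec ι) (As : ℕ → Matrix κ ι ℝ),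
    x ∈ U → (∀ k, xs k ∈ U) → (∀ k, As k ∈ J (xs k)) →
    Tendsto xs atTop (𝓝 x) → Tendsto As atTop (𝓝 A) → A ∈ J x
  locallyBounded : ∀ x ∈ U, ∃ M : ℝ, ∀ᶠ y in 𝓝[U] x, ∀ A ∈ J y, ∀ i j, |A i j| ≤ M
  chainRule : ∀ γ : ℝ → Vec ι, IsACCurve γ → (∀ t, γ t ∈ U) →
    ∀ᵐ t : ℝ, ∀ A ∈ J (γ t),
      HasDerivAt (fun s => F (γ s)) (Matrix.toEuclideanLin A (deriv γ t)) t

/-- `D` is a conservative gradient (field) of the real-valued function `f` on `U`: the same notion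
as a conservative Jacobian for a scalar function, the `1 × n` matrices being replaced by the
corresponding vectors of `ℝ^ι`. -/
structure IsConservativeGradientOn {ι : Type} [Fintype ι]
    (U : Set (Vec ι)) (f : Vec ι → ℝ) (D : Vec ι → Set (Vec ι)) : Prop where
  locallyLipschitz : LocallyLipschitzOn U f
  nonempty : ∀ x ∈ U, (D x).Nonempty
  closedGraph : ∀ (x v : Vec ι) (xs vs : ℕ → Vec ι),
    x ∈ U → (∀ k, xs k ∈ U) → (∀ k, vs k ∈ D (xs k)) →
    Tendsto xs atTop (𝓝 x) → Tendsto vs atTop (𝓝 v) → v ∈ D x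
  locallyBounded : ∀ x ∈ U, ∃ M : ℝ, ∀ᶠ y in 𝓝[U] x, ∀ v ∈ D y, ‖v‖ ≤ M
  chainRule : ∀ γ : ℝ → Vec ι, IsACCurve γ → (∀ t, γ t ∈ U) →
    ∀ᵐ t : ℝ, ∀ v ∈ D (γ t), HasDerivAt (fun s => f (γ s)) (inner ℝ v (deriv γ t)) t

/-- A real-valued function is path differentiable on `U` if it is locally Lipschitz there and
has a conservative gradient. -/
def IsPathDifferentiableOn {ι : Type} [Fintype ι] (U : Set (Vec ι)) (f : Vec ι → ℝ) : Prop :=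
  ∃ D : Vec ι → Set (Vec ι), IsConservativeGradientOn U f D

/-- `σ` is the proximal operator of a proper convex function `ℝ^m → ℝ ∪ {+∞}`. The function is
given by its effective domain `C` and its finite values `φ` on `C`; for every `x`, the point
`σ x` minimizes `φ y + ‖y - x‖² / 2` over `y ∈ C`. -/
def IsProxOfConvex {m : ℕ} (σ : Vec (Fin m) → Vec (Fin m)) : Prop :=
  ∃ (C : Set (Vec (Fin m))) (φ : Vec (Fin m) → ℝ), ConvexOn ℝ C φ ∧
    ∀ x, σ x ∈ C ∧ IsMinOn (fun y => φ y + ‖y - x‖ ^ 2 / 2) C (σ x)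

/-- The monotonicity condition on the weights: for some `θ > 0`,
`(I - W) + (I - W)ᵀ ⪰ 2 θ I`. -/
def IsMonotoneWeight {m : ℕ} (W : Matrix (Fin m) (Fin m) ℝ) : Prop :=
  ∃ θ : ℝ, 0 < θ ∧
    ((1 - W) + (1 - W).transpose - (2 * θ) • (1 : Matrix (Fin m) (Fin m) ℝ)).PosSemidef

/-- The affine map `W z + b`. -/
noncomputable def affine {m : ℕ} (W : Matrix (Fin m) (Fin m) ℝ) (b z : Vec (Fin m)) :
    Vec (Fin m) :=
  Matrix.toEuclideanLin W z + b

/-- `z` solves the layer equation `z = σ (W z + b)`. -/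
def IsLayerOutput {m : ℕ} (σ : Vec (Fin m) → Vec (Fin m)) (W : Matrix (Fin m) (Fin m) ℝ)
    (b z : Vec (Fin m)) : Prop :=
  z = σ (affine W b z)

/-- The space `ℝ^(m × m) × ℝ^m ≅ ℝ^(m² + m)` of the parameters `(W, b)`, with its Euclidean
structure. -/
abbrev Param (m : ℕ) : Type := Vec ((Fin m × Fin m) ⊕ Fin m)

/-- The pair `(W, b)` as a point of the parameter space. -/
noncomputable def mkParam {m : ℕ} (W : Matrix (Fin m) (Fin m) ℝ) (b : Vec (Fin m)) : Param m :=
  WithLp.toLp 2 (Sum.elim (fun ij : Fin m × Fin m => W ij.1 ij.2) (fun i => b i))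

/-- The matrix `W` of a parameter `p = (W, b)`. -/
def weight {m : ℕ} (p : Param m) : Matrix (Fin m) (Fin m) ℝ :=
  Matrix.of fun i j => p (Sum.inl (i, j))

/-- The bias `b` of a parameter `p = (W, b)`. -/
noncomputable def bias {m : ℕ} (p : Param m) : Vec (Fin m) :=
  WithLp.toLp 2 fun i => p (Sum.inr i)

/-- The vector `Jᵀ (I - J W)^{-T} v`. -/
noncomputable def adjointVec {m : ℕ} (W J : Matrix (Fin m) (Fin m) ℝ) (v : Vec (Fin m)) :
    Vec (Fin m) :=
  Matrix.toEuclideanLin (J.transpose * ((1 - J * W)⁻¹).transpose) v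

/-- The set of all pairs `(Jᵀ (I - J W)^{-T} v zᵀ, Jᵀ (I - J W)^{-T} v)` with
`J ∈ Jσ (W z + b)` and `v ∈ Dℓ z`, where `p = (W, b)` and `z = z p`. -/
def layerGradient {m : ℕ} (Jσ : Vec (Fin m) → Set (Matrix (Fin m) (Fin m) ℝ))
    (Dℓ : Vec (Fin m) → Set (Vec (Fin m))) (z : Param m → Vec (Fin m)) (p : Param m) :
    Set (Param m) :=
  {q | ∃ J ∈ Jσ (affine (weight p) (bias p) (z p)), ∃ v ∈ Dℓ (z p),
    q = mkParam (Matrix.vecMulVec (adjointVec (weight p) J v) (z p))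
      (adjointVec (weight p) J v)}

end MonotoneLayer

/-! A proximal operator is firmly nonexpansive, and monotonicity of `W` means `⟨y, W y⟩ ≤ (1 -
θ)‖y‖²`. Setting `u = 2z - W z - b` turns the layer equation into `u = (2σ - id)(W z + b)`. The
reflection `2σ - id` is nonexpansive and `W (2 - W)⁻¹` is a strict contraction, so Banach's theorem
gives a solution. The same two inequalities bound the difference of solutions for different data
(`FirmlyNonexpansive.norm_sub_solution_le`), whence uniqueness and local Lipschitz dependence of `z`
on `(W, b)`.

For the gradient, implicit differentiation is done along curves only. If `γ` is absolutely
continuous, so are `z ∘ γ` and the argument `W z + b` of `σ`. The chain rule of `Jσ` then gives, at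
almost every time and for every `J` at once, `d = J (W d + W' z + b')`, where `d` is the velocity of
`z ∘ γ`. Inverting `I - J W`, pairing with `v ∈ Dℓ` and transposing yields the stated formula
(`layerGradient_chainRule`). Closed graph and local boundedness both follow from sequential
compactness of the values (`HasSubseqLimits`), which passes from `Jσ` and `Dℓ` to `layerGradient`
because the formula is continuous where `I - J W` is invertible. -/

namespace MonotoneLayer

open MeasureTheory Topology Filter
open scoped NNReal

/-! ### Proximal operators and the equation `z = σ (T z + b)` in an inner product space. -/

section Hilbert

variable {E : Type*} [NormedAddCommGroup E] [InnerProductSpace ℝ E]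

/-- `σ` is firmly nonexpansive. -/
def FirmlyNonexpansive (σ : E → E) : Prop :=
  ∀ x y, ‖σ x - σ y‖ ^ 2 ≤ inner ℝ (σ x - σ y) (x - y)

/-- The variational inequality characterizing a proximal point. -/
theorem prox_variational_inequality {C : Set E} {φ : E → ℝ} (hφ : ConvexOn ℝ C φ) {x p y : E}
    (hp : p ∈ C) (hmin : IsMinOn (fun y => φ y + ‖y - x‖ ^ 2 / 2) C p) (hy : y ∈ C) :
    φ p + inner ℝ (x - p) (y - p) ≤ φ y := by
  -- Compare `p` with `(1 - t) p + t y`, use convexity, and divide by `t`; the limit `t → 0` removes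
  -- the quadratic remainder.
  have key : ∀ t : ℝ, 0 < t → t ≤ 1 →
      φ p + inner ℝ (x - p) (y - p) - φ y ≤ t * (‖y - p‖ ^ 2 / 2) := by
    intro t ht0 ht1
    have h1t : 0 ≤ 1 - t := by linarith
    have hmem := hφ.1 hp hy h1t ht0.le (by ring)
    have hc := hφ.2 hp hy h1t ht0.le (by ring)
    have hm : φ p + ‖p - x‖ ^ 2 / 2 ≤ _ := hmin hmem
    have e : (1 - t) • p + t • y - x = (p - x) + t • (y - p) := by module
    have e2 : inner ℝ (p - x) (y - p) = - inner ℝ (x - p) (y - p) := by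
      rw [← inner_neg_left, neg_sub]
    beta_reduce at hm
    rw [e, norm_add_sq_real, real_inner_smul_right, norm_smul, mul_pow, Real.norm_eq_abs, sq_abs,
      e2] at hm
    simp only [smul_eq_mul] at hc
    have : t * (φ p + inner ℝ (x - p) (y - p) - φ y) ≤ t * (t * (‖y - p‖ ^ 2 / 2)) := by
      nlinarith
    exact le_of_mul_le_mul_left this ht0
  have hlim : Tendsto (fun t : ℝ => t * (‖y - p‖ ^ 2 / 2)) (𝓝[>] 0) (𝓝 0) := by
    have : Tendsto (fun t : ℝ => t * (‖y - p‖ ^ 2 / 2)) (𝓝 0) (𝓝 (0 * (‖y - p‖ ^ 2 / 2))) :=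
      tendsto_id.mul_const _
    rw [zero_mul] at this
    exact this.mono_left nhdsWithin_le_nhds
  have := ge_of_tendsto hlim (b := φ p + inner ℝ (x - p) (y - p) - φ y) (by
    filter_upwards [Ioc_mem_nhdsGT (zero_lt_one' ℝ)] with t ht using key t ht.1 ht.2)
  linarith

/-- Add the variational inequalities at `x` and at `y`, each tested with the other proximal point;
the values of `φ` cancel. -/
theorem firmlyNonexpansive_of_prox {C : Set E} {φ : E → ℝ} (hφ : ConvexOn ℝ C φ) {σ : E → E}
    (hσ : ∀ x, σ x ∈ C ∧ IsMinOn (fun y => φ y + ‖y - x‖ ^ 2 / 2) C (σ x)) :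
    FirmlyNonexpansive σ := by
  intro x y
  have h1 := prox_variational_inequality hφ (hσ x).1 (hσ x).2 (hσ y).1
  have h2 := prox_variational_inequality hφ (hσ y).1 (hσ y).2 (hσ x).1
  have e : inner ℝ (x - σ x) (σ y - σ x) + inner ℝ (y - σ y) (σ x - σ y)
      = ‖σ x - σ y‖ ^ 2 - inner ℝ (σ x - σ y) (x - y) := by
    rw [← real_inner_self_eq_norm_sq, ← neg_sub (σ x) (σ y), inner_neg_right,
      real_inner_comm, real_inner_comm (σ x - σ y) (y - σ y), ← sub_eq_neg_add, ← inner_sub_right,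
      ← inner_sub_right]
    congr 1
    abel
  linarith

theorem FirmlyNonexpansive.norm_reflection_le {σ : E → E} (hσ : FirmlyNonexpansive σ) (x y : E) :
    ‖((2 : ℝ) • σ x - x) - ((2 : ℝ) • σ y - y)‖ ≤ ‖x - y‖ := by
  have e : ((2 : ℝ) • σ x - x) - ((2 : ℝ) • σ y - y) = (2 : ℝ) • (σ x - σ y) - (x - y) := by
    module
  rw [e]
  apply le_of_sq_le_sq _ (norm_nonneg _)
  rw [norm_sub_sq_real, norm_smul, real_inner_smul_left, mul_pow]
  have := hσ x y
  norm_num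
  linarith

/-- Dependence of solutions of `z = σ (T z + b)` on `(T, b)`, where `1 - T` is strongly monotone. -/
theorem FirmlyNonexpansive.norm_sub_solution_le {σ : E → E} (hσ : FirmlyNonexpansive σ)
    {T T' : E →L[ℝ] E} {θ : ℝ} (hT : ∀ y, inner ℝ y (T y) ≤ (1 - θ) * ‖y‖ ^ 2)
    {b b' z z' : E} (hz : z = σ (T z + b)) (hz' : z' = σ (T' z' + b')) :
    θ * ‖z - z'‖ ≤ ‖(T - T') z' + (b - b')‖ := by
  have h := hσ (T z + b) (T' z' + b')
  rw [← hz, ← hz'] at h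
  have e : T z + b - (T' z' + b') = T (z - z') + ((T - T') z' + (b - b')) := by
    simp only [map_sub, sub_apply]
    abel
  rw [e, inner_add_right] at h
  have h1 := hT (z - z')
  have h2 := real_inner_le_norm (z - z') ((T - T') z' + (b - b'))
  rcases (norm_nonneg (z - z')).eq_or_lt with h0 | h0
  · rw [← h0, mul_zero]
    exact norm_nonneg _
  · refine le_of_mul_le_mul_left ?_ h0
    nlinarith

theorem FirmlyNonexpansive.existsUnique_solution [FiniteDimensional ℝ E] {σ : E → E}
    (hσ : FirmlyNonexpansive σ) {T : E →L[ℝ] E} {θ : ℝ} (hθ : 0 < θ)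
    (hT : ∀ y, inner ℝ y (T y) ≤ (1 - θ) * ‖y‖ ^ 2) (b : E) : ∃! z, z = σ (T z + b) := by
  have : CompleteSpace E := FiniteDimensional.complete ℝ E
  let A : E →L[ℝ] E := (2 : ℝ) • ContinuousLinearMap.id ℝ E - T
  have hA : ∀ y, A y = (2 : ℝ) • y - T y := fun y => rfl
  -- `‖(2 - T) y‖² - ‖T y‖² = 4‖y‖² - 4⟨y, T y⟩`, which is at least `4θ‖y‖²`.
  have hTA : ∀ y, ‖T y‖ ^ 2 + 4 * θ * ‖y‖ ^ 2 ≤ ‖A y‖ ^ 2 := by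
    intro y
    rw [hA, norm_sub_sq_real, norm_smul, real_inner_smul_left, mul_pow]
    have := hT y
    norm_num
    linarith
  have hinj : Function.Injective (A : E →ₗ[ℝ] E) := by
    rw [← LinearMap.ker_eq_bot, LinearMap.ker_eq_bot']
    intro y hy
    have h0 : A y = 0 := hy
    have := hTA y
    rw [h0, norm_zero] at this
    have h1 : ‖y‖ ^ 2 ≤ 0 := by
      have : 0 ≤ ‖T y‖ ^ 2 := by positivity
      nlinarith
    simpa using h1
  let e := LinearEquiv.ofInjectiveEndo (A : E →ₗ[ℝ] E) hinj
  have he : ∀ u, A (e.symm u) = u := fun u => e.apply_symm_apply u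
  -- An upper bound for `‖A‖`, enlarged so that `a² ≥ (1 + 2θ)² > 4θ`: the radicand below is then
  -- positive.
  set a : ℝ := ‖A‖ + 1 + 2 * θ with ha
  have ha1 : 1 + 2 * θ ≤ a := by
    have := norm_nonneg A
    linarith
  have ha0 : 0 < a := by linarith
  have hq : 4 * θ / a ^ 2 < 1 := by
    rw [div_lt_one (by positivity)]
    nlinarith
  have hcontr : ∀ y, ‖T y‖ ≤ √(1 - 4 * θ / a ^ 2) * ‖A y‖ := by
    intro y
    apply le_of_sq_le_sq _ (by positivity)
    rw [mul_pow, Real.sq_sqrt (by linarith)]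
    have h1 : ‖A y‖ ≤ a * ‖y‖ :=
      (A.le_opNorm y).trans (by gcongr; linarith)
    have h2 : ‖A y‖ ^ 2 ≤ a ^ 2 * ‖y‖ ^ 2 := by
      rw [← mul_pow]; gcongr
    have h3 : 4 * θ / a ^ 2 * ‖A y‖ ^ 2 ≤ 4 * θ * ‖y‖ ^ 2 := by
      rw [div_mul_eq_mul_div, div_le_iff₀ (by positivity)]
      nlinarith
    have := hTA y
    linarith
  -- With `z = A⁻¹ (u + b)`, this is the reflection `2σ - id` at `T z + b`. If `Φ u = u`, then `2σ(T
  -- z + b) = u + T z + b = 2z`.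
  let Φ : E → E := fun u =>
    (2 : ℝ) • σ (T (e.symm (u + b)) + b) - (T (e.symm (u + b)) + b)
  have hΦ : ContractingWith (√(1 - 4 * θ / a ^ 2)).toNNReal Φ := by
    refine ⟨?_, LipschitzWith.of_dist_le_mul fun u u' => ?_⟩
    · rw [← NNReal.coe_lt_coe, Real.coe_toNNReal _ (Real.sqrt_nonneg _), NNReal.coe_one,
        Real.sqrt_lt' one_pos]
      have : 0 < 4 * θ / a ^ 2 := by positivity
      linarith
    · rw [dist_eq_norm, dist_eq_norm]
      refine (hσ.norm_reflection_le _ _).trans ?_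
      rw [add_sub_add_right_eq_sub, ← map_sub, ← map_sub, add_sub_add_right_eq_sub]
      refine (hcontr _).trans ?_
      rw [he, Real.coe_toNNReal _ (Real.sqrt_nonneg _)]
  have hfix : Φ (hΦ.fixedPoint Φ) = hΦ.fixedPoint Φ := hΦ.fixedPoint_isFixedPt
  set u := hΦ.fixedPoint Φ
  have hsol : e.symm (u + b) = σ (T (e.symm (u + b)) + b) := by
    have h1 := he (u + b)
    have h2 : (2 : ℝ) • σ (T (e.symm (u + b)) + b) - (T (e.symm (u + b)) + b) = u := hfix
    rw [hA] at h1
    refine smul_right_injective E (two_ne_zero' ℝ) ?_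
    rw [sub_eq_iff_eq_add] at h1 h2
    beta_reduce
    rw [h1, h2]
    abel
  refine ⟨e.symm (u + b), hsol, fun z hz => ?_⟩
  have h5 := hσ.norm_sub_solution_le hT hz hsol
  rw [sub_self, sub_self, zero_apply, add_zero, norm_zero] at h5
  have h6 : ‖z - e.symm (u + b)‖ ≤ 0 := by
    by_contra! h
    nlinarith
  exact sub_eq_zero.1 (norm_le_zero_iff.1 h6)

end Hilbert

/-! ### Locally Lipschitz maps and absolutely continuous curves. -/

section Curves

theorem LocallyLipschitzOn.comp_mapsTo {X Y Z : Type*} [PseudoEMetricSpace X]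
    [PseudoEMetricSpace Y] [PseudoEMetricSpace Z] {g : Y → Z} {f : X → Y} {s : Set X} {t : Set Y}
    (hg : LocallyLipschitzOn t g) (hf : LocallyLipschitzOn s f) (h : Set.MapsTo f s t) :
    LocallyLipschitzOn s (fun x => g (f x)) := by
  intro x hx
  obtain ⟨K, v, hv, hKv⟩ := hf hx
  obtain ⟨L, w, hw, hLw⟩ := hg (h hx)
  have hc : Tendsto f (𝓝[s] x) (𝓝[t] (f x)) :=
    tendsto_nhdsWithin_of_tendsto_nhds_of_eventually_within _ (hf.continuousOn x hx)
      (by filter_upwards [self_mem_nhdsWithin] with y hy using h hy)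
  exact ⟨L * K, v ∩ f ⁻¹' w, inter_mem hv (hc hw),
    hLw.comp (hKv.mono Set.inter_subset_left) fun y hy => hy.2⟩

theorem LocallyLipschitzOn.prodMk_id {X Y : Type*} [PseudoEMetricSpace X] [PseudoEMetricSpace Y]
    {f : X → Y} {s : Set X} (hf : LocallyLipschitzOn s f) :
    LocallyLipschitzOn s (fun x => (x, f x)) := by
  intro x hx
  obtain ⟨K, v, hv, hKv⟩ := hf hx
  exact ⟨max 1 K, v, hv, (LipschitzWith.id.lipschitzOnWith).prodMk hKv⟩

theorem LipschitzOnWith.comp_absolutelyContinuousOnInterval {X Y : Type*} [PseudoMetricSpace X]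
    [PseudoMetricSpace Y] {f : X → Y} {γ : ℝ → X} {K : ℝ≥0} {a b : ℝ}
    (hf : LipschitzOnWith K f (γ '' Set.uIcc a b)) (hγ : AbsolutelyContinuousOnInterval γ a b) :
    AbsolutelyContinuousOnInterval (fun t => f (γ t)) a b := by
  rw [absolutelyContinuousOnInterval_iff] at hγ ⊢
  intro ε hε
  obtain ⟨δ, hδ, h⟩ := hγ (ε / (K + 1)) (by positivity)
  refine ⟨δ, hδ, fun I hI hIδ => ?_⟩
  calc
    _ ≤ ∑ i ∈ Finset.range I.1, (K + 1) * dist (γ (I.2 i).1) (γ (I.2 i).2) := by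
      refine Finset.sum_le_sum fun i hi => ?_
      refine (hf.dist_le_mul _ (Set.mem_image_of_mem _ (hI.1 i hi).1) _
        (Set.mem_image_of_mem _ (hI.1 i hi).2)).trans ?_
      gcongr
      linarith
    _ = (K + 1) * ∑ i ∈ Finset.range I.1, dist (γ (I.2 i).1) (γ (I.2 i).2) :=
      (Finset.mul_sum _ _ _).symm
    _ < (K + 1) * (ε / (K + 1)) := by gcongr; exact h I hI hIδ
    _ = ε := by field_simp

variable {ι κ : Type} [Fintype ι] [Fintype κ]

/-- On a compact interval the curve has compact image, where a locally Lipschitz map is Lipschitz.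
-/
theorem IsACCurve.comp_locallyLipschitzOn {γ : ℝ → Vec ι} (hγ : IsACCurve γ) {U : Set (Vec ι)}
    (hU : ∀ t, γ t ∈ U) {f : Vec ι → Vec κ} (hf : LocallyLipschitzOn U f) :
    IsACCurve (fun t => f (γ t)) := by
  intro a b
  have hc : IsCompact (γ '' Set.uIcc a b) := isCompact_uIcc.image_of_continuousOn (hγ a b).continuousOn
  obtain ⟨K, hK⟩ := LocallyLipschitzOn.exists_lipschitzOnWith_of_compact hc
    (hf.mono (Set.image_subset_iff.2 fun t _ => hU t))
  exact LipschitzOnWith.comp_absolutelyContinuousOnInterval hK (hγ a b)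

theorem IsACCurve.ae_differentiableAt {γ : ℝ → Vec ι} (hγ : IsACCurve γ) :
    ∀ᵐ t : ℝ, DifferentiableAt ℝ γ t := by
  have h : ∀ᵐ t : ℝ, ∀ n : ℕ, t ∈ Set.uIcc (-(n : ℝ)) n → DifferentiableAt ℝ γ t :=
    ae_all_iff.2 fun n => (hγ _ _).boundedVariationOn.ae_differentiableAt_of_mem_uIcc
  filter_upwards [h] with t ht
  obtain ⟨n, hn⟩ := exists_nat_ge |t|
  exact ht n (Set.Icc_subset_uIcc (abs_le.1 hn))

end Curves

/-! ### Sequential compactness, closed graphs and local boundedness. -/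

section Subsequences

/-- Sequential compactness of the values near every point of `U`. -/
def HasSubseqLimits {X Y : Type*} [TopologicalSpace X] [TopologicalSpace Y] (U : Set X)
    (D : X → Set Y) : Prop :=
  ∀ (x : X) (xs : ℕ → X) (vs : ℕ → Y), x ∈ U → (∀ k, xs k ∈ U) →
    (∀ k, vs k ∈ D (xs k)) → Tendsto xs atTop (𝓝 x) →
    ∃ v ∈ D x, ∃ φ : ℕ → ℕ, StrictMono φ ∧ Tendsto (vs ∘ φ) atTop (𝓝 v)

theorem HasSubseqLimits.mem_of_tendsto {X Y : Type*} [TopologicalSpace X]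
    [TopologicalSpace Y] [T2Space Y] {U : Set X} {D : X → Set Y}
    (h : HasSubseqLimits U D) {x : X} {v : Y} {xs : ℕ → X} {vs : ℕ → Y}
    (hx : x ∈ U) (hxs : ∀ k, xs k ∈ U) (hvs : ∀ k, vs k ∈ D (xs k))
    (hlim : Tendsto xs atTop (𝓝 x)) (hv : Tendsto vs atTop (𝓝 v)) : v ∈ D x := by
  obtain ⟨w, hw, φ, hφ, hlw⟩ := h x xs vs hx hxs hvs hlim
  rwa [tendsto_nhds_unique (hv.comp hφ.tendsto_atTop) hlw]

/-- Otherwise values with norms tending to infinity could be chosen over points converging to `x`,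
and no subsequence of them would converge. -/
theorem HasSubseqLimits.locallyBounded {X Y : Type*} [PseudoMetricSpace X]
    [SeminormedAddCommGroup Y] {U : Set X} {D : X → Set Y} (h : HasSubseqLimits U D) {x : X} (hx : x ∈ U) :
    ∃ M : ℝ, ∀ᶠ y in 𝓝[U] x, ∀ v ∈ D y, ‖v‖ ≤ M := by
  by_contra! hcon
  have hex : ∀ n : ℕ, ∃ y ∈ U, dist y x < 1 / ((n : ℝ) + 1) ∧ ∃ v ∈ D y, (n : ℝ) < ‖v‖ := by
    intro n
    have hball : ∀ᶠ y in 𝓝[U] x, y ∈ U ∧ dist y x < 1 / ((n : ℝ) + 1) :=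
      Filter.Eventually.and self_mem_nhdsWithin (mem_nhdsWithin_of_mem_nhds (Metric.ball_mem_nhds x (by positivity)))
    obtain ⟨y, hy, hyU, hyd⟩ := ((hcon n).and_eventually hball).exists
    exact ⟨y, hyU, hyd, hy⟩
  choose xs hxs hd vs hvs hn using hex
  have hlim : Tendsto xs atTop (𝓝 x) := tendsto_iff_dist_tendsto_zero.2
    (squeeze_zero (fun _ => dist_nonneg) (fun n => (hd n).le) tendsto_one_div_add_atTop_nhds_zero_nat)
  obtain ⟨w, -, φ, hφ, hlw⟩ := h x xs vs hx hxs hvs hlim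
  have htop : Tendsto (fun n => ‖vs (φ n)‖) atTop atTop :=
    tendsto_atTop_mono (fun n => (hn (φ n)).le)
      (tendsto_natCast_atTop_atTop.comp hφ.tendsto_atTop)
  exact not_tendsto_nhds_of_tendsto_atTop htop _ hlw.norm

variable {ι κ : Type} [Fintype ι] [Fintype κ]

theorem IsConservativeJacobianOn.exists_tendsto_subseq [DecidableEq ι] {U : Set (Vec ι)}
    {F : Vec ι → Vec κ} {J : Vec ι → Set (Matrix κ ι ℝ)} (h : IsConservativeJacobianOn U F J)
    {x : Vec ι} {xs : ℕ → Vec ι} {As : ℕ → Matrix κ ι ℝ} (hx : x ∈ U) (hxs : ∀ k, xs k ∈ U)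
    (hAs : ∀ k, As k ∈ J (xs k)) (hlim : Tendsto xs atTop (𝓝 x)) :
    ∃ A ∈ J x, ∃ φ : ℕ → ℕ, StrictMono φ ∧ Tendsto (As ∘ φ) atTop (𝓝 A) := by
  obtain ⟨M, hM⟩ := h.locallyBounded x hx
  have hc : IsCompact (Set.univ.pi fun _ : κ => Set.univ.pi fun _ : ι => Set.Icc (-M) M) :=
    isCompact_univ_pi fun _ => isCompact_univ_pi fun _ => isCompact_Icc
  have hev : ∀ᶠ k in atTop,
      As k ∈ Set.univ.pi fun _ : κ => Set.univ.pi fun _ : ι => Set.Icc (-M) M := by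
    have ht := tendsto_nhdsWithin_of_tendsto_nhds_of_eventually_within _ hlim
      (Eventually.of_forall hxs)
    filter_upwards [ht.eventually hM] with k hk
    exact fun i _ j _ => abs_le.1 (hk _ (hAs k) i j)
  obtain ⟨A, -, φ, hφ, hA⟩ := IsCompact.tendsto_subseq' (X := κ → ι → ℝ) hc hev.frequently
  exact ⟨A, h.closedGraph x A (xs ∘ φ) (As ∘ φ) hx (fun k => hxs _) (fun k => hAs _)
    (hlim.comp hφ.tendsto_atTop) hA, φ, hφ, hA⟩

theorem IsConservativeGradientOn.exists_tendsto_subseq {U : Set (Vec ι)}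
    {f : Vec ι → ℝ} {D : Vec ι → Set (Vec ι)} (h : IsConservativeGradientOn U f D)
    {x : Vec ι} {xs vs : ℕ → Vec ι} (hx : x ∈ U) (hxs : ∀ k, xs k ∈ U)
    (hvs : ∀ k, vs k ∈ D (xs k)) (hlim : Tendsto xs atTop (𝓝 x)) :
    ∃ v ∈ D x, ∃ φ : ℕ → ℕ, StrictMono φ ∧ Tendsto (vs ∘ φ) atTop (𝓝 v) := by
  obtain ⟨M, hM⟩ := h.locallyBounded x hx
  have hev : ∀ᶠ k in atTop, vs k ∈ Metric.closedBall (0 : Vec ι) M := by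
    have ht := tendsto_nhdsWithin_of_tendsto_nhds_of_eventually_within _ hlim
      (Eventually.of_forall hxs)
    filter_upwards [ht.eventually hM] with k hk
    exact mem_closedBall_zero_iff.2 (hk _ (hvs k))
  obtain ⟨v, -, φ, hφ, hv⟩ := (isCompact_closedBall (0 : Vec ι) M).tendsto_subseq' hev.frequently
  exact ⟨v, h.closedGraph x v (xs ∘ φ) (vs ∘ φ) hx (fun k => hxs _) (fun k => hvs _)
    (hlim.comp hφ.tendsto_atTop) hv, φ, hφ, hv⟩

end Subsequences

/-! ### The layer output: existence, Lipschitz dependence, derivative along curves. -/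

section Layer

variable {m : ℕ}

/-- The operator of the weight, as a linear function of the parameter. -/
noncomputable def weightCLM (m : ℕ) : Param m →L[ℝ] Vec (Fin m) →L[ℝ] Vec (Fin m) :=
  LinearMap.toContinuousLinearMap
    { toFun := fun p => LinearMap.toContinuousLinearMap (Matrix.toEuclideanLin (weight p))
      map_add' := fun p q => by
        rw [← map_add, ← map_add]
        rfl
      map_smul' := fun c p => by
        rw [RingHom.id_apply, ← map_smul, ← map_smul]
        rfl }

/-- The bias, as a linear function of the parameter. -/
noncomputable def biasCLM (m : ℕ) : Param m →L[ℝ] Vec (Fin m) :=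
  LinearMap.toContinuousLinearMap
    { toFun := bias
      map_add' := fun _ _ => rfl
      map_smul' := fun _ _ => rfl }

theorem weightCLM_apply (p : Param m) (z : Vec (Fin m)) :
    weightCLM m p z = Matrix.toEuclideanLin (weight p) z := rfl

theorem affine_eq (p : Param m) (z : Vec (Fin m)) :
    affine (weight p) (bias p) z = weightCLM m p z + biasCLM m p := rfl

/-- `W` and `Wᵀ` have the same quadratic form, so the matrix inequality is twice this one. -/
theorem IsMonotoneWeight.exists_inner_le {p : Param m} (h : IsMonotoneWeight (weight p)) :
    ∃ θ : ℝ, 0 < θ ∧ ∀ y, inner ℝ y (weightCLM m p y) ≤ (1 - θ) * ‖y‖ ^ 2 := by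
  obtain ⟨θ, hθ, hW⟩ := h
  refine ⟨θ, hθ, fun y => ?_⟩
  have h1 := hW.dotProduct_mulVec_nonneg y.ofLp
  have h2 : inner ℝ y (weightCLM m p y) = y.ofLp ⬝ᵥ (weight p).mulVec y.ofLp := by
    rw [EuclideanSpace.inner_eq_star_dotProduct, star_trivial, dotProduct_comm]
    rfl
  have h3 : ‖y‖ ^ 2 = y.ofLp ⬝ᵥ y.ofLp := by
    rw [← real_inner_self_eq_norm_sq, EuclideanSpace.inner_eq_star_dotProduct, star_trivial]
  have h4 : y.ofLp ⬝ᵥ (weight p).transpose.mulVec y.ofLp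
      = y.ofLp ⬝ᵥ (weight p).mulVec y.ofLp := by
    rw [Matrix.mulVec_transpose, dotProduct_comm, Matrix.dotProduct_mulVec]
  simp only [star_trivial, Matrix.transpose_sub, Matrix.transpose_one, Matrix.sub_mulVec,
    Matrix.add_mulVec, Matrix.smul_mulVec, Matrix.one_mulVec, dotProduct_sub, dotProduct_add,
    dotProduct_smul, smul_eq_mul, h4] at h1
  rw [h2, h3]
  linarith

theorem IsProxOfConvex.firmlyNonexpansive {σ : Vec (Fin m) → Vec (Fin m)}
    (hσ : IsProxOfConvex σ) : FirmlyNonexpansive σ := by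
  obtain ⟨C, φ, hφ, h⟩ := hσ
  exact firmlyNonexpansive_of_prox hφ h

theorem existsUnique_isLayerOutput {σ : Vec (Fin m) → Vec (Fin m)} (hσ : FirmlyNonexpansive σ)
    {W : Matrix (Fin m) (Fin m) ℝ} (hW : IsMonotoneWeight W) (b : Vec (Fin m)) :
    ∃! z, IsLayerOutput σ W b z := by
  obtain ⟨θ, hθ, h⟩ := IsMonotoneWeight.exists_inner_le (p := mkParam W b) hW
  exact hσ.existsUnique_solution hθ h b

attribute [irreducible] weightCLM
attribute [irreducible] biasCLM

theorem isLayerOutput_iff {σ : Vec (Fin m) → Vec (Fin m)} {p : Param m} {z : Vec (Fin m)} :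
    IsLayerOutput σ (weight p) (bias p) z ↔ z = σ (weightCLM m p z + biasCLM m p) := by
  rw [IsLayerOutput, affine_eq]

theorem locallyLipschitzOn_layerOutput {σ : Vec (Fin m) → Vec (Fin m)}
    (hσ : FirmlyNonexpansive σ) {U : Set (Param m)}
    (hmono : ∀ p ∈ U, IsMonotoneWeight (weight p)) {z : Param m → Vec (Fin m)}
    (hz : ∀ p ∈ U, IsLayerOutput σ (weight p) (bias p) (z p)) : LocallyLipschitzOn U z := by
  intro p₀ hp₀
  obtain ⟨θ, hθ, hT⟩ := (hmono p₀ hp₀).exists_inner_le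
  set K := ‖weightCLM m‖
  set L := ‖biasCLM m‖
  have hK : 0 ≤ K := norm_nonneg (weightCLM m)
  have hL : 0 ≤ L := norm_nonneg (biasCLM m)
  -- Within this radius the perturbation of `W` costs at most half of `θ`; the `+ 1` covers `K = 0`.
  set r : ℝ := θ / 2 / (K + 1) with hr
  have hr0 : 0 < r := by positivity
  have hKr : K * r ≤ θ / 2 := by
    rw [hr, mul_div_assoc', div_le_iff₀ (by positivity)]
    nlinarith
  have hclose : ∀ p ∈ Metric.ball p₀ r, ∀ y,
      inner ℝ y (weightCLM m p y) ≤ (1 - θ / 2) * ‖y‖ ^ 2 := by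
    intro p hp y
    have h1 : inner ℝ y (weightCLM m p y)
        = inner ℝ y (weightCLM m p₀ y) + inner ℝ y (weightCLM m (p - p₀) y) := by
      rw [← inner_add_right, map_sub, sub_apply, add_sub_cancel]
    have h2 : inner ℝ y (weightCLM m (p - p₀) y) ≤ θ / 2 * ‖y‖ ^ 2 := by
      calc _ ≤ ‖y‖ * ‖weightCLM m (p - p₀) y‖ := real_inner_le_norm _ _
        _ ≤ ‖y‖ * (K * ‖p - p₀‖ * ‖y‖) := by
          gcongr
          exact (weightCLM m).le_opNorm₂ _ _
        _ ≤ ‖y‖ * (K * r * ‖y‖) := by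
          gcongr
          exact (mem_ball_iff_norm.1 hp).le
        _ ≤ ‖y‖ * (θ / 2 * ‖y‖) := by gcongr
        _ = θ / 2 * ‖y‖ ^ 2 := by ring
    have := hT y
    rw [h1]
    linarith
  -- The constant depends on `‖z q‖`. Taking `q = p₀` first bounds `z` on the ball by `M`, which
  -- then makes the constant uniform.
  have hest : ∀ p ∈ U ∩ Metric.ball p₀ r, ∀ q ∈ U,
      ‖z p - z q‖ ≤ 2 / θ * (K * ‖z q‖ + L) * ‖p - q‖ := by
    intro p hp q hq
    have h := hσ.norm_sub_solution_le (hclose p hp.2) (isLayerOutput_iff.1 (hz p hp.1))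
      (isLayerOutput_iff.1 (hz q hq))
    have h2 : ‖(weightCLM m p - weightCLM m q) (z q) + (biasCLM m p - biasCLM m q)‖
        ≤ (K * ‖z q‖ + L) * ‖p - q‖ := by
      rw [← map_sub, ← map_sub]
      calc _ ≤ K * ‖p - q‖ * ‖z q‖ + L * ‖p - q‖ :=
            norm_add_le_of_le ((weightCLM m).le_opNorm₂ _ _) ((biasCLM m).le_opNorm _)
        _ = _ := by ring
    have h3 : θ / 2 * ‖z p - z q‖ ≤ (K * ‖z q‖ + L) * ‖p - q‖ := h.trans h2
    calc ‖z p - z q‖ = 2 / θ * (θ / 2 * ‖z p - z q‖) := by field_simp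
      _ ≤ 2 / θ * ((K * ‖z q‖ + L) * ‖p - q‖) := by gcongr
      _ = _ := by ring
  set M : ℝ := ‖z p₀‖ + 2 / θ * (K * ‖z p₀‖ + L) * r
  have hM : ∀ p ∈ U ∩ Metric.ball p₀ r, ‖z p‖ ≤ M := by
    intro p hp
    have h1 : ‖z p - z p₀‖ ≤ 2 / θ * (K * ‖z p₀‖ + L) * r :=
      (hest p hp p₀ hp₀).trans (by gcongr; exact (mem_ball_iff_norm.1 hp.2).le)
    have h2 := norm_sub_norm_le (z p) (z p₀)
    linarith
  refine ⟨(2 / θ * (K * M + L)).toNNReal, U ∩ Metric.ball p₀ r,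
    inter_mem_nhdsWithin _ (Metric.ball_mem_nhds _ hr0), LipschitzOnWith.of_dist_le_mul ?_⟩
  intro p hp q hq
  rw [dist_eq_norm, dist_eq_norm]
  refine (hest p hp q hq.1).trans ?_
  gcongr
  refine le_trans ?_ (Real.le_coe_toNNReal _)
  gcongr
  exact hM q hq

theorem contDiff_affine :
    ContDiff ℝ 1 (fun q : Param m × Vec (Fin m) => affine (weight q.1) (bias q.1) q.2) := by
  simp only [affine_eq]
  exact (((weightCLM m).contDiff.comp contDiff_fst).clm_apply contDiff_snd).add
    ((biasCLM m).contDiff.comp contDiff_fst)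

theorem locallyLipschitzOn_affine {U : Set (Param m)} {z : Param m → Vec (Fin m)}
    (hz : LocallyLipschitzOn U z) :
    LocallyLipschitzOn U (fun p => affine (weight p) (bias p) (z p)) := by
  have h := LocallyLipschitzOn.comp_mapsTo
    (locallyLipschitzOn_univ.2 (contDiff_affine (m := m)).locallyLipschitz)
    (LocallyLipschitzOn.prodMk_id hz) (Set.mapsTo_univ _ _)
  exact h

/-- The adjoint of `(W, b) ↦ W z + b` is `u ↦ (u zᵀ, u)`: the source of the rank-one block in the
gradient. -/
theorem inner_mkParam_vecMulVec (u z : Vec (Fin m)) (q : Param m) :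
    inner ℝ (mkParam (Matrix.vecMulVec u z) u) q
      = inner ℝ u (affine (weight q) (bias q) z) := by
  simp only [PiLp.inner_apply, Fintype.sum_sum_type, Fintype.sum_prod_type, mkParam, affine,
    bias, weight, Matrix.toLpLin_apply, PiLp.add_apply, Matrix.mulVec, dotProduct,
    Matrix.vecMulVec_apply, Matrix.of_apply, Sum.elim_inl, Sum.elim_inr, RCLike.inner_apply,
    conj_trivial, add_mul, Finset.sum_add_distrib, Finset.sum_mul]
  congr 1
  refine Finset.sum_congr rfl fun i _ => Finset.sum_congr rfl fun j _ => ?_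
  ring

theorem inner_adjointVec (W J : Matrix (Fin m) (Fin m) ℝ) (v w : Vec (Fin m)) :
    inner ℝ (adjointVec W J v) w
      = inner ℝ v (Matrix.toEuclideanLin ((1 - J * W)⁻¹ * J) w) := by
  rw [EuclideanSpace.inner_eq_star_dotProduct, EuclideanSpace.inner_eq_star_dotProduct,
    star_trivial, star_trivial, adjointVec, ← Matrix.transpose_mul, Matrix.toLpLin_apply,
    Matrix.toLpLin_apply, Matrix.mulVec_transpose, dotProduct_comm, ← Matrix.dotProduct_mulVec,
    dotProduct_comm]

/-- The linear equation `d = J (W d + w)` is solved by `d = (1 - J W)⁻¹ J w`. -/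
theorem inner_eq_inner_adjointVec {W J : Matrix (Fin m) (Fin m) ℝ} (hJ : IsUnit (1 - J * W))
    {d w : Vec (Fin m)}
    (h : d = Matrix.toEuclideanLin J (Matrix.toEuclideanLin W d + w)) (v : Vec (Fin m)) :
    inner ℝ v d = inner ℝ (adjointVec W J v) w := by
  rw [inner_adjointVec]
  congr 1
  have h1 : Matrix.toEuclideanLin (1 - J * W) d = Matrix.toEuclideanLin J w := by
    conv_rhs at h => rw [map_add]
    simp only [Matrix.toLpLin_apply] at h ⊢
    rw [Matrix.sub_mulVec, Matrix.one_mulVec, ← Matrix.mulVec_mulVec, WithLp.toLp_sub,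
      WithLp.toLp_ofLp, sub_eq_iff_eq_add']
    exact h
  simp only [Matrix.toLpLin_apply] at h1 ⊢
  have h2 := congrArg WithLp.ofLp h1
  simp only at h2
  rw [← Matrix.mulVec_mulVec, ← h2, Matrix.mulVec_mulVec,
    Matrix.nonsing_inv_mul _ ((Matrix.isUnit_iff_isUnit_det _).1 hJ), Matrix.one_mulVec]

theorem continuousAt_matrix_inv_of_isUnit {A : Matrix (Fin m) (Fin m) ℝ} (hA : IsUnit A) :
    ContinuousAt Inv.inv A := by
  refine continuousAt_matrix_inv A ?_
  rw [Ring.inverse_eq_inv']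
  exact continuousAt_inv₀ ((Matrix.isUnit_iff_isUnit_det _).1 hA).ne_zero

theorem continuous_toEuclideanLin_apply :
    Continuous fun q : Matrix (Fin m) (Fin m) ℝ × Vec (Fin m) =>
      Matrix.toEuclideanLin q.1 q.2 := by
  simp only [Matrix.toLpLin_apply]
  fun_prop

theorem continuous_mkParam_vecMulVec :
    Continuous fun q : Vec (Fin m) × Vec (Fin m) => mkParam (Matrix.vecMulVec q.1 q.2) q.1 := by
  refine (PiLp.continuous_toLp 2 _).comp (continuous_pi fun i => ?_)
  rcases i with ij | i
  · simp only [Sum.elim_inl, Matrix.vecMulVec_apply]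
    fun_prop
  · simp only [Sum.elim_inr]
    fun_prop

theorem tendsto_adjointVec {α : Type*} {l : Filter α}
    {Ws Js : α → Matrix (Fin m) (Fin m) ℝ} {vs : α → Vec (Fin m)}
    {W J : Matrix (Fin m) (Fin m) ℝ} {v : Vec (Fin m)} (hJW : IsUnit (1 - J * W))
    (hW : Tendsto Ws l (𝓝 W)) (hJ : Tendsto Js l (𝓝 J)) (hv : Tendsto vs l (𝓝 v)) :
    Tendsto (fun k => adjointVec (Ws k) (Js k) (vs k)) l (𝓝 (adjointVec W J v)) := by
  have hinv : Tendsto (fun k => (1 - Js k * Ws k)⁻¹) l (𝓝 (1 - J * W)⁻¹) :=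
    (continuousAt_matrix_inv_of_isUnit hJW).tendsto.comp (tendsto_const_nhds.sub (hJ.mul hW))
  have hT : Continuous (Matrix.transpose : Matrix (Fin m) (Fin m) ℝ → _) :=
    continuous_id.matrix_transpose
  have hprod := ((hT.tendsto _).comp hJ).mul ((hT.tendsto _).comp hinv)
  have h := (continuous_toEuclideanLin_apply.tendsto
    (J.transpose * (1 - J * W)⁻¹.transpose, v)).comp (hprod.prodMk_nhds hv)
  exact h

theorem continuous_weight : Continuous (weight : Param m → Matrix (Fin m) (Fin m) ℝ) := by
  refine continuous_pi fun i => continuous_pi fun j => ?_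
  exact (EuclideanSpace.proj (𝕜 := ℝ) (Sum.inl (i, j) : (Fin m × Fin m) ⊕ Fin m)).continuous

/-- Extract a limit `J` of the Jacobians, then along that subsequence a limit `v` of the gradients.
Invertibility of `I - J W` at the limit makes the formula continuous there. -/
theorem hasSubseqLimits_layerGradient {σ : Vec (Fin m) → Vec (Fin m)}
    {Jσ : Vec (Fin m) → Set (Matrix (Fin m) (Fin m) ℝ)}
    (hJσ : IsConservativeJacobianOn Set.univ σ Jσ) {U : Set (Param m)}
    {z : Param m → Vec (Fin m)} (hz : ContinuousOn z U)
    (hinv : ∀ p ∈ U, ∀ J ∈ Jσ (affine (weight p) (bias p) (z p)), IsUnit (1 - J * weight p))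
    {ℓ : Vec (Fin m) → ℝ} {Dℓ : Vec (Fin m) → Set (Vec (Fin m))}
    (hℓ : IsConservativeGradientOn Set.univ ℓ Dℓ) :
    HasSubseqLimits U (layerGradient Jσ Dℓ z) := by
  intro p ps qs hp hps hqs hlim
  choose Js hJs vs hvs hq using hqs
  have hzlim : Tendsto (fun k => z (ps k)) atTop (𝓝 (z p)) :=
    (hz p hp).tendsto.comp (tendsto_nhdsWithin_of_tendsto_nhds_of_eventually_within _ hlim
      (Eventually.of_forall hps))
  have hxlim : Tendsto (fun k => affine (weight (ps k)) (bias (ps k)) (z (ps k))) atTop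
      (𝓝 (affine (weight p) (bias p) (z p))) := by
    have h := (contDiff_affine.continuous.tendsto (p, z p)).comp (hlim.prodMk_nhds hzlim)
    exact h
  obtain ⟨J, hJ, φ, hφ, hJlim⟩ :=
    hJσ.exists_tendsto_subseq (Set.mem_univ _) (fun _ => Set.mem_univ _) hJs hxlim
  obtain ⟨v, hv, ψ, hψ, hvlim⟩ := hℓ.exists_tendsto_subseq (Set.mem_univ _)
    (fun _ => Set.mem_univ _) (fun k => hvs (φ k)) (hzlim.comp hφ.tendsto_atTop)
  have hφψ : Tendsto (φ ∘ ψ) atTop atTop := hφ.tendsto_atTop.comp hψ.tendsto_atTop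
  refine ⟨_, ⟨J, hJ, v, hv, rfl⟩, φ ∘ ψ, hφ.comp hψ, ?_⟩
  have hu := tendsto_adjointVec (hinv p hp J hJ)
    (((continuous_weight.tendsto p).comp hlim).comp hφψ) (hJlim.comp hψ.tendsto_atTop) hvlim
  have h := (continuous_mkParam_vecMulVec.tendsto (adjointVec (weight p) J v, z p)).comp
    (hu.prodMk_nhds (hzlim.comp hφψ))
  exact h.congr fun k => (hq (φ (ψ k))).symm

theorem layerGradient_chainRule {σ : Vec (Fin m) → Vec (Fin m)}
    {Jσ : Vec (Fin m) → Set (Matrix (Fin m) (Fin m) ℝ)}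
    (hJσ : IsConservativeJacobianOn Set.univ σ Jσ) {U : Set (Param m)}
    {z : Param m → Vec (Fin m)} (hz : LocallyLipschitzOn U z)
    (hout : ∀ p ∈ U, IsLayerOutput σ (weight p) (bias p) (z p))
    (hinv : ∀ p ∈ U, ∀ J ∈ Jσ (affine (weight p) (bias p) (z p)), IsUnit (1 - J * weight p))
    {ℓ : Vec (Fin m) → ℝ} {Dℓ : Vec (Fin m) → Set (Vec (Fin m))}
    (hℓ : IsConservativeGradientOn Set.univ ℓ Dℓ) {γ : ℝ → Param m} (hγ : IsACCurve γ)
    (hU : ∀ t, γ t ∈ U) :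
    ∀ᵐ t : ℝ, ∀ q ∈ layerGradient Jσ Dℓ z (γ t),
      HasDerivAt (fun s => ℓ (z (γ s))) (inner ℝ q (deriv γ t)) t := by
  have hzγ : IsACCurve (fun t => z (γ t)) := hγ.comp_locallyLipschitzOn hU hz
  have hxγ := hγ.comp_locallyLipschitzOn hU (locallyLipschitzOn_affine hz)
  filter_upwards [hγ.ae_differentiableAt, hzγ.ae_differentiableAt,
    hJσ.chainRule _ hxγ fun _ => Set.mem_univ _, hℓ.chainRule _ hzγ fun _ => Set.mem_univ _]
    with t hγt hzt hσt hℓt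
  rintro q ⟨J, hJ, v, hv, rfl⟩
  have hx : HasDerivAt (fun s => affine (weight (γ s)) (bias (γ s)) (z (γ s)))
      (weightCLM m (deriv γ t) (z (γ t)) + weightCLM m (γ t) (deriv (fun s => z (γ s)) t)
        + biasCLM m (deriv γ t)) t := by
    simp only [affine_eq]
    exact (((weightCLM m).hasFDerivAt.comp_hasDerivAt t hγt.hasDerivAt).clm_apply
      hzt.hasDerivAt).add ((biasCLM m).hasFDerivAt.comp_hasDerivAt t hγt.hasDerivAt)
  have hd := hσt J hJ
  rw [hx.deriv] at hd
  -- Since `z = σ (W z + b)` along the whole curve, the derivative of the right side is also that of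
  -- `z ∘ γ`.
  have hd' : HasDerivAt (fun s => z (γ s)) _ t :=
    hd.congr_of_eventuallyEq (Eventually.of_forall fun s => hout (γ s) (hU s))
  have heq := hzt.hasDerivAt.unique hd'
  have hlin : deriv (fun s => z (γ s)) t = Matrix.toEuclideanLin J
      (Matrix.toEuclideanLin (weight (γ t)) (deriv (fun s => z (γ s)) t)
        + affine (weight (deriv γ t)) (bias (deriv γ t)) (z (γ t))) := by
    refine heq.trans (congrArg _ ?_)
    rw [affine_eq, add_comm (weightCLM m (deriv γ t) _), add_assoc, weightCLM_apply (γ t)]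
  rw [inner_mkParam_vecMulVec, ← inner_eq_inner_adjointVec (hinv _ (hU t) J hJ) hlin v]
  exact hℓt v hv

end Layer

end MonotoneLayer

/-! ### The main theorem. -/

theorem proposition3 {m : ℕ}
    (σ : MonotoneLayer.Vec (Fin m) → MonotoneLayer.Vec (Fin m))
    (hσ : MonotoneLayer.IsProxOfConvex σ)
    (Jσ : MonotoneLayer.Vec (Fin m) → Set (Matrix (Fin m) (Fin m) ℝ))
    (hJσ : MonotoneLayer.IsConservativeJacobianOn Set.univ σ Jσ)
    (hconv : ∀ x, Convex ℝ (Jσ x))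
    (U : Set (MonotoneLayer.Param m)) (hU : IsOpen U)
    (hmono : ∀ p ∈ U, MonotoneLayer.IsMonotoneWeight (MonotoneLayer.weight p))
    (hinv : ∀ p ∈ U, ∀ z : MonotoneLayer.Vec (Fin m),
      MonotoneLayer.IsLayerOutput σ (MonotoneLayer.weight p) (MonotoneLayer.bias p) z →
      ∀ J ∈ Jσ (MonotoneLayer.affine (MonotoneLayer.weight p) (MonotoneLayer.bias p) z),
        IsUnit (1 - J * MonotoneLayer.weight p))
    (ℓ : MonotoneLayer.Vec (Fin m) → ℝ)
    (Dℓ : MonotoneLayer.Vec (Fin m) → Set (MonotoneLayer.Vec (Fin m)))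
    (hℓ : MonotoneLayer.IsConservativeGradientOn Set.univ ℓ Dℓ) :
    (∀ W : Matrix (Fin m) (Fin m) ℝ, MonotoneLayer.IsMonotoneWeight W →
      ∀ b : MonotoneLayer.Vec (Fin m), ∃! z, MonotoneLayer.IsLayerOutput σ W b z) ∧
    ∀ z : MonotoneLayer.Param m → MonotoneLayer.Vec (Fin m),
      (∀ p ∈ U, MonotoneLayer.IsLayerOutput σ (MonotoneLayer.weight p)
        (MonotoneLayer.bias p) (z p)) →
      MonotoneLayer.IsPathDifferentiableOn U (fun p => ℓ (z p)) ∧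
      MonotoneLayer.IsConservativeGradientOn U (fun p => ℓ (z p))
        (MonotoneLayer.layerGradient Jσ Dℓ z) := by
  have hfirm := hσ.firmlyNonexpansive
  refine ⟨fun W hW b => MonotoneLayer.existsUnique_isLayerOutput hfirm hW b, fun z hz => ?_⟩
  have hlip := MonotoneLayer.locallyLipschitzOn_layerOutput hfirm hmono hz
  have hinv' := fun p hp => hinv p hp (z p) (hz p hp)
  have hsub := MonotoneLayer.hasSubseqLimits_layerGradient hJσ hlip.continuousOn hinv' hℓ
  have hgrad : MonotoneLayer.IsConservativeGradientOn U (fun p => ℓ (z p))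
      (MonotoneLayer.layerGradient Jσ Dℓ z) :=
    { locallyLipschitz := MonotoneLayer.LocallyLipschitzOn.comp_mapsTo hℓ.locallyLipschitz hlip
        (Set.mapsTo_univ _ _)
      nonempty := fun p hp => by
        obtain ⟨J, hJ⟩ := hJσ.nonempty
          (MonotoneLayer.affine (MonotoneLayer.weight p) (MonotoneLayer.bias p) (z p))
          (Set.mem_univ _)
        obtain ⟨v, hv⟩ := hℓ.nonempty (z p) (Set.mem_univ _)
        exact ⟨_, J, hJ, v, hv, rfl⟩
      closedGraph := fun p q ps qs hp hps hqs hlim hq =>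
        hsub.mem_of_tendsto hp hps hqs hlim hq
      locallyBounded := fun p hp => hsub.locallyBounded hp
      chainRule := fun γ hγ hγU =>
        MonotoneLayer.layerGradient_chainRule hJσ hlip hz hinv' hℓ hγ hγU }
  exact ⟨⟨_, hgrad⟩, hgrad⟩
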